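/- For $n \ge 1$ let $B_n$ be the linear polyomino chain with $n$ squares, i.e. the graph with vertices $u_1,\dots,u_{n+1},v_1,\dots,v_{n+1}$ and edges $u_iu_{i+1}$, $v_iv_{i+1}$ $(1\le i\le n)$ and $u_iv_i$ $(1\le i\le n+1)$. Let $B_n^2$ be its strong prism, i.e. the strong product $B_n\boxtimes K_2$, in which two distinct vertices $(x,a)$ and $(y,b)$ are adjacent whenever $x,y$ are equal or adjacent in $B_n$ and $a,b$ are equal or adjacent in $K_2$. For a connected graph $G$ with vertices $v_1,\dots,v_N$ and degrees $d_1,\dots,d_N$, let $d_{ij}$ be the length of a shortest path between $v_i$ and $v_j$, and let $r_{ij}$ be the resistance distance, i.e. the effective resistance between $v_i$ and $v_j$ when every edge of $G$ is a unit resistor. Let $$Kf^*(G)=\sum_{i<j} d_i d_j r_{ij},\qquad Gut(G)=\sum_{i<j} d_i d_j d_{ij}$$ be the degree-Kirchhoff index and the Gutman index of $G$. Then $$\lim_{n\to\infty}\frac{Kf^*(B_n^2)}{Gut(B_n^2)}=\frac18 .$$ -/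

import Mathlib

open Filter Topology Matrix

/-- The strong product `G ⊠ H`: two distinct vertices `(u₁, v₁)` and `(u₂, v₂)` are adjacent
whenever `u₁, u₂` are equal or adjacent in `G` and `v₁, v₂` are equal or adjacent in `H`. -/
def strongProduct {V W : Type*} (G : SimpleGraph V) (H : SimpleGraph W) :
    SimpleGraph (V × W) where
  Adj x y := x ≠ y ∧ (x.1 = y.1 ∨ G.Adj x.1 y.1) ∧ (x.2 = y.2 ∨ H.Adj x.2 y.2)
  symm := ⟨fun _ _ h => ⟨h.1.symm, h.2.1.imp Eq.symm (fun a => a.symm),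
    h.2.2.imp Eq.symm (fun a => a.symm)⟩⟩
  loopless := ⟨fun _ h => h.1 rfl⟩

instance {V W : Type*} [DecidableEq V] [DecidableEq W] (G : SimpleGraph V) (H : SimpleGraph W)
    [DecidableRel G.Adj] [DecidableRel H.Adj] : DecidableRel (strongProduct G H).Adj :=
  fun x y => inferInstanceAs
    (Decidable (x ≠ y ∧ (x.1 = y.1 ∨ G.Adj x.1 y.1) ∧ (x.2 = y.2 ∨ H.Adj x.2 y.2)))

/-- The strong prism of `G`: the strong product of `G` and `K₂`. -/
abbrev strongPrism {V : Type*} (G : SimpleGraph V) : SimpleGraph (V × Fin 2) :=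
  strongProduct G (⊤ : SimpleGraph (Fin 2))

/-- The linear polyomino chain `B_n` with `n` squares in a row. The vertices `(0, i)` and `(1, i)`
are `u_{i+1}` and `v_{i+1}` (`0 ≤ i ≤ n`). Two vertices are joined if they agree in the
first coordinate and have consecutive second coordinates, or differ in the first coordinate and
agree in the second one. -/
def linearPolyominoChain (n : ℕ) : SimpleGraph (Fin 2 × Fin (n + 1)) where
  Adj x y := (x.1 = y.1 ∧ ((x.2 : ℕ) + 1 = y.2 ∨ (y.2 : ℕ) + 1 = x.2)) ∨ (x.1 ≠ y.1 ∧ x.2 = y.2)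
  symm := ⟨fun _ _ h => h.imp (fun a => ⟨a.1.symm, a.2.symm⟩) (fun a => ⟨a.1.symm, a.2.symm⟩)⟩
  loopless := ⟨fun x h => by
    rcases h with h | h
    · rcases h.2 with h | h <;> omega
    · exact h.1 rfl⟩

instance (n : ℕ) : DecidableRel (linearPolyominoChain n).Adj :=
  fun x y => inferInstanceAs (Decidable
    ((x.1 = y.1 ∧ ((x.2 : ℕ) + 1 = y.2 ∨ (y.2 : ℕ) + 1 = x.2)) ∨ (x.1 ≠ y.1 ∧ x.2 = y.2)))

section Indices

variable {V : Type*} [Fintype V] [DecidableEq V] (G : SimpleGraph V) [DecidableRel G.Adj]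

/-- `φ` is an electric potential on the network with a unit resistor on each edge of `G`, when a
unit current enters at `i` and leaves at `j`: by Ohm's law the current from `x` to a neighbour `y`
is `φ x - φ y`, and by Kirchhoff's current law the net current `∑_{y ∼ x} (φ x - φ y)` out of `x`
along the edges is the current fed in at `x` from outside. -/
def IsUnitPotential (i j : V) (φ : V → ℝ) : Prop :=
  ∀ x, ∑ y ∈ G.neighborFinset x, (φ x - φ y) =
    (if x = i then 1 else 0) - (if x = j then 1 else 0)

open Classical in
/-- The resistance distance `r_{ij}`: the effective resistance between `i` and `j` when each edge is
a unit resistor, that is, the potential difference that drives a unit current from `i` to `j`. It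
does not depend on the chosen potential, see `resistanceDist_eq`. (Such a potential exists when `i`
and `j` lie in the same connected component; only connected graphs are of interest here.) -/
noncomputable def resistanceDist (i j : V) : ℝ :=
  if h : ∃ φ, IsUnitPotential G i j φ then h.choose i - h.choose j else 0

/-- The degree-Kirchhoff index `∑_{i<j} d_i d_j r_{ij}`, written as half the sum over all ordered
pairs (the summand is symmetric and vanishes for `i = j`). -/
noncomputable def degreeKirchhoffIndex : ℝ :=
  (1 / 2) * ∑ i, ∑ j, (G.degree i : ℝ) * (G.degree j : ℝ) * resistanceDist G i j

/-- The Gutman index `∑_{i<j} d_i d_j d_{ij}`, with `d_{ij}` the length of a shortest path, written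
as half the sum over all ordered pairs (the summand is symmetric and vanishes for `i = j`). -/
noncomputable def gutmanIndex : ℝ :=
  (1 / 2) * ∑ i, ∑ j, (G.degree i : ℝ) * (G.degree j : ℝ) * (G.dist i j : ℝ)

variable {G}

theorem isUnitPotential_iff {i j : V} {φ : V → ℝ} : IsUnitPotential G i j φ ↔
    G.lapMatrix ℝ *ᵥ φ = Pi.single i 1 - Pi.single j 1 := by
  rw [funext_iff]
  refine forall_congr' fun x => ?_
  rw [SimpleGraph.lapMatrix_mulVec_apply, Finset.sum_sub_distrib, Finset.sum_const,
    SimpleGraph.card_neighborFinset_eq_degree, nsmul_eq_mul, Pi.sub_apply, Pi.single_apply,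
    Pi.single_apply]

/-- The resistance distance may be computed from any unit potential. -/
theorem resistanceDist_eq {i j : V} {φ : V → ℝ} (hφ : IsUnitPotential G i j φ) :
    resistanceDist G i j = φ i - φ j := by
  have key : ∀ ψ : V → ℝ, (Pi.single i 1 - Pi.single j 1 : V → ℝ) ⬝ᵥ ψ = ψ i - ψ j := by
    intro ψ
    rw [sub_dotProduct, single_one_dotProduct, single_one_dotProduct]
  have h : ∃ φ, IsUnitPotential G i j φ := ⟨φ, hφ⟩
  have hψ := h.choose_spec
  rw [resistanceDist, dif_pos h]
  rw [isUnitPotential_iff] at hφ hψ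
  rw [← key, ← key]
  conv_lhs => rw [← hφ]
  rw [← hψ, dotProduct_comm, dotProduct_mulVec, ← mulVec_transpose,
    (SimpleGraph.isSymm_lapMatrix (R := ℝ) G).eq]

theorem resistanceDist_self (i : V) : resistanceDist G i i = 0 := by
  unfold resistanceDist
  split_ifs <;> simp

theorem resistanceDist_comm (i j : V) : resistanceDist G i j = resistanceDist G j i := by
  have neg : ∀ {a b : V} {φ : V → ℝ}, IsUnitPotential G a b φ → IsUnitPotential G b a (-φ) := by
    intro a b φ h
    rw [isUnitPotential_iff] at h ⊢
    rw [mulVec_neg, h, neg_sub]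
  by_cases h : ∃ φ, IsUnitPotential G i j φ
  · obtain ⟨φ, hφ⟩ := h
    rw [resistanceDist_eq hφ, resistanceDist_eq (neg hφ)]
    simp only [Pi.neg_apply]
    ring
  · have h' : ¬∃ φ, IsUnitPotential G j i φ := fun ⟨φ, hφ⟩ => h ⟨-φ, neg hφ⟩
    rw [resistanceDist, resistanceDist, dif_neg h, dif_neg h']

end Indices

/-! Group the vertices into layers by their position along the chain. Each layer is a clique on four
vertices, and consecutive layers are joined by 8 edges. Distance is thus the layer difference up to
1. Resistance is an eighth of the layer difference up to 2: layer averages of a unit potential drop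
by 1/8 per layer (`sum_layer_sub_sum_layer`), and by the maximum principle each terminal is within 1
of its layer average (`abs_source_sub_layer_sum`). Since degrees are at most 12, the
degree-Kirchhoff index differs from an eighth of the Gutman index by O(n²), while the Gutman index
grows at least like n³. -/

/-! ### Unit potentials on a connected network. -/

section Potentials

variable {V : Type*} [Fintype V] [DecidableEq V] {G : SimpleGraph V} [DecidableRel G.Adj]

theorem IsUnitPotential.neg {i j : V} {φ : V → ℝ} (h : IsUnitPotential G i j φ) :
    IsUnitPotential G j i (-φ) := by
  rw [isUnitPotential_iff] at h ⊢
  rw [mulVec_neg, h, neg_sub]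

theorem sum_lapMatrix_mulVec (φ : V → ℝ) : ∑ x, (G.lapMatrix ℝ *ᵥ φ) x = 0 := by
  have h : ∑ x, (G.lapMatrix ℝ *ᵥ φ) x = (fun _ => (1 : ℝ)) ⬝ᵥ (G.lapMatrix ℝ *ᵥ φ) := by
    simp [dotProduct]
  rw [h, dotProduct_mulVec, ← mulVec_transpose,
    (SimpleGraph.isSymm_lapMatrix (R := ℝ) G).eq, SimpleGraph.lapMatrix_mulVec_const_eq_zero,
    zero_dotProduct]

/-- On a connected network, any two vertices admit a unit potential. -/
theorem exists_isUnitPotential (hG : G.Connected) (i j : V) :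
    ∃ φ, IsUnitPotential G i j φ := by
  have := hG.nonempty
  have hcard : (Fintype.card V : ℝ) ≠ 0 := by exact_mod_cast Fintype.card_ne_zero
  -- The Laplacian plus the all-ones matrix is invertible: the added term removes the kernel of
  -- constants and vanishes on solutions whose right-hand side has sum zero.
  let T : (V → ℝ) →ₗ[ℝ] (V → ℝ) :=
    { toFun := fun φ x => (G.lapMatrix ℝ *ᵥ φ) x + ∑ y, φ y
      map_add' := fun φ ψ => by
        funext x
        simp only [mulVec_add, Pi.add_apply, Finset.sum_add_distrib]
        ring
      map_smul' := fun c φ => by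
        funext x
        simp only [mulVec_smul, Pi.smul_apply, smul_eq_mul, ← Finset.mul_sum, RingHom.id_apply]
        ring }
  have hsum : ∀ φ : V → ℝ, ∑ x, T φ x = Fintype.card V * ∑ y, φ y := by
    intro φ
    change ∑ x, ((G.lapMatrix ℝ *ᵥ φ) x + ∑ y, φ y) = _
    rw [Finset.sum_add_distrib, sum_lapMatrix_mulVec, zero_add, Finset.sum_const,
      Finset.card_univ, nsmul_eq_mul]
  have hT : ∀ (φ : V → ℝ), ∑ y, φ y = 0 → T φ = G.lapMatrix ℝ *ᵥ φ := by
    intro φ h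
    funext x
    change (G.lapMatrix ℝ *ᵥ φ) x + ∑ y, φ y = _
    rw [h, add_zero]
  have hinj : Function.Injective T := by
    rw [← LinearMap.ker_eq_bot, LinearMap.ker_eq_bot']
    intro φ h
    have h0 : ∑ y, φ y = 0 := by
      have := hsum φ
      rw [h] at this
      simpa [hcard] using this
    have hL := hT φ h0
    rw [h] at hL
    have hc := (SimpleGraph.lapMatrix_mulVec_eq_zero_iff_forall_reachable G).1 hL.symm
    funext x
    have : ∑ y, φ y = Fintype.card V * φ x := by
      rw [Finset.sum_congr rfl (fun y _ => hc y x (hG.preconnected y x)), Finset.sum_const,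
        Finset.card_univ, nsmul_eq_mul]
    rw [h0] at this
    simpa [hcard] using this.symm
  obtain ⟨φ, hφ⟩ := LinearMap.injective_iff_surjective.1 hinj (Pi.single i 1 - Pi.single j 1)
  have h0 : ∑ y, φ y = 0 := by
    have := hsum φ
    rw [hφ] at this
    simpa [hcard] using this
  exact ⟨φ, isUnitPotential_iff.2 (by rw [← hT φ h0, hφ])⟩

/-- Maximum principle: a unit potential is largest at the source. -/
theorem IsUnitPotential.le_source (hG : G.Connected) {i j : V} {φ : V → ℝ}
    (h : IsUnitPotential G i j φ) (x : V) : φ x ≤ φ i := by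
  have := hG.nonempty
  obtain ⟨m, hm⟩ := Finite.exists_max φ
  suffices hi : φ i = φ m by rw [hi]; exact hm x
  -- Away from the source the net outflow is 0 or -1, so a maximum passes to all neighbours.
  have step : ∀ a b : V, G.Adj a b → φ a = φ m → a = i ∨ φ b = φ m := by
    intro a b hab ha
    by_contra hcon
    push Not at hcon
    have hlt : φ b < φ m := lt_of_le_of_ne (hm b) hcon.2
    have hpos : 0 < ∑ y ∈ G.neighborFinset a, (φ a - φ y) := by
      refine Finset.sum_pos' (fun y _ => ?_) ⟨b, by simpa using hab, ?_⟩
      · rw [ha]; linarith [hm y]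
      · rw [ha]; linarith
    rw [h a, if_neg hcon.1] at hpos
    split_ifs at hpos <;> linarith
  have walk : ∀ a : V, G.Walk a i → φ a = φ m → φ i = φ m := by
    intro a p
    induction p with
    | nil => exact id
    | cons hab p ih =>
      intro ha
      rcases step _ _ hab ha with rfl | hb
      · exact ha
      · exact ih h step hb
  exact walk m (hG.preconnected m i).some rfl

/-- The current along an edge at the source is at most the total current. -/
theorem IsUnitPotential.source_le_add_one (hG : G.Connected) {i j : V} {φ : V → ℝ}
    (h : IsUnitPotential G i j φ) {x : V} (hx : G.Adj i x) : φ i ≤ φ x + 1 := by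
  have h1 : φ i - φ x ≤ ∑ y ∈ G.neighborFinset i, (φ i - φ y) :=
    Finset.single_le_sum (f := fun y => φ i - φ y)
      (fun y _ => sub_nonneg.2 (h.le_source hG y)) (by simpa using hx)
  rw [h i, if_pos rfl] at h1
  split_ifs at h1 <;> linarith

/-- Pairing a unit potential with the Laplacian of a test function. -/
theorem IsUnitPotential.sum_mul_laplacian {i j : V} {φ : V → ℝ}
    (h : IsUnitPotential G i j φ) (f : V → ℝ) :
    ∑ x, φ x * ∑ y ∈ G.neighborFinset x, (f x - f y) = f i - f j := by
  have hf : ∀ x, ∑ y ∈ G.neighborFinset x, (f x - f y) = (G.lapMatrix ℝ *ᵥ f) x := by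
    intro x
    rw [SimpleGraph.lapMatrix_mulVec_apply, Finset.sum_sub_distrib, Finset.sum_const,
      SimpleGraph.card_neighborFinset_eq_degree, nsmul_eq_mul]
  simp_rw [hf]
  change φ ⬝ᵥ (G.lapMatrix ℝ *ᵥ f) = _
  rw [dotProduct_mulVec, ← mulVec_transpose, (SimpleGraph.isSymm_lapMatrix (R := ℝ) G).eq,
    isUnitPotential_iff.1 h, sub_dotProduct, single_one_dotProduct, single_one_dotProduct]

end Potentials

/-! ### Layers, distances and degrees in the prism. -/

section Prism

variable {n : ℕ}

theorem strongPrism_chain_adj_iff (x y : (Fin 2 × Fin (n + 1)) × Fin 2) :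
    (strongPrism (linearPolyominoChain n)).Adj x y ↔
      (x.1.2 = y.1.2 ∧ x ≠ y) ∨
        (x.1.1 = y.1.1 ∧ ((x.1.2 : ℕ) + 1 = y.1.2 ∨ (y.1.2 : ℕ) + 1 = x.1.2)) := by
  obtain ⟨⟨r, k⟩, a⟩ := x
  obtain ⟨⟨s, l⟩, b⟩ := y
  simp only [strongPrism, strongProduct, linearPolyominoChain, SimpleGraph.top_adj, ne_eq,
    Prod.mk.injEq, em, and_true, Fin.ext_iff]
  omega

theorem strongPrism_chain_adj_of_layer_eq {x y : (Fin 2 × Fin (n + 1)) × Fin 2}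
    (h : x.1.2 = y.1.2) (hne : x ≠ y) : (strongPrism (linearPolyominoChain n)).Adj x y :=
  (strongPrism_chain_adj_iff x y).2 (Or.inl ⟨h, hne⟩)

theorem exists_walk_along_row (r a : Fin 2) (d : ℕ) : ∀ k l : Fin (n + 1), (k : ℕ) + d = l →
    ∃ p : (strongPrism (linearPolyominoChain n)).Walk ((r, k), a) ((r, l), a), p.length = d := by
  induction d with
  | zero =>
    intro k l h
    obtain rfl : k = l := Fin.ext (by omega)
    exact ⟨.nil, rfl⟩
  | succ d ih =>
    intro k l h
    obtain ⟨p, hp⟩ := ih ⟨k + 1, by omega⟩ l (by simp only; omega)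
    have hadj : (strongPrism (linearPolyominoChain n)).Adj ((r, k), a)
        ((r, ⟨k + 1, by omega⟩), a) :=
      (strongPrism_chain_adj_iff _ _).2 (Or.inr ⟨rfl, Or.inl rfl⟩)
    exact ⟨.cons hadj p, by simp [hp]⟩

theorem exists_walk_length_le {x y : (Fin 2 × Fin (n + 1)) × Fin 2}
    (h : (x.1.2 : ℕ) ≤ y.1.2) :
    ∃ p : (strongPrism (linearPolyominoChain n)).Walk x y,
      p.length ≤ (y.1.2 : ℕ) - x.1.2 + 1 := by
  obtain ⟨⟨r, k⟩, a⟩ := x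
  obtain ⟨⟨s, l⟩, b⟩ := y
  obtain ⟨p, hp⟩ := exists_walk_along_row r a ((l : ℕ) - k) k l (by simp only at h; omega)
  by_cases hne : (((r, l), a) : (Fin 2 × Fin (n + 1)) × Fin 2) = ((s, l), b)
  · rw [← hne]
    exact ⟨p, by simp only; omega⟩
  · exact ⟨p.concat (strongPrism_chain_adj_of_layer_eq rfl hne), by
      rw [SimpleGraph.Walk.length_concat]; simp only; omega⟩

theorem strongPrism_chain_connected (n : ℕ) :
    (strongPrism (linearPolyominoChain n)).Connected := by
  refine (SimpleGraph.connected_iff _).2 ⟨fun x y => ?_, inferInstance⟩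
  rcases le_total (x.1.2 : ℕ) y.1.2 with h | h
  · exact ⟨(exists_walk_length_le h).choose⟩
  · exact ⟨(exists_walk_length_le h).choose.reverse⟩

theorem strongPrism_chain_dist_le (x y : (Fin 2 × Fin (n + 1)) × Fin 2) :
    ((strongPrism (linearPolyominoChain n)).dist x y : ℝ) ≤
      |(x.1.2 : ℝ) - (y.1.2 : ℝ)| + 1 := by
  wlog h : (x.1.2 : ℕ) ≤ y.1.2 generalizing x y
  · rw [SimpleGraph.dist_comm, abs_sub_comm]
    exact this y x (le_of_not_ge h)
  obtain ⟨p, hp⟩ := exists_walk_length_le h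
  have h1 := (SimpleGraph.dist_le p).trans hp
  have h2 : (strongPrism (linearPolyominoChain n)).dist x y + (x.1.2 : ℕ) ≤ y.1.2 + 1 := by omega
  have h3 : ((strongPrism (linearPolyominoChain n)).dist x y : ℝ) + (x.1.2 : ℕ) ≤
      (y.1.2 : ℕ) + 1 := by exact_mod_cast h2
  rw [abs_sub_comm]
  linarith [le_abs_self ((y.1.2 : ℝ) - (x.1.2 : ℝ))]

theorem abs_layer_sub_le_length {x y : (Fin 2 × Fin (n + 1)) × Fin 2}
    (p : (strongPrism (linearPolyominoChain n)).Walk x y) :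
    |(x.1.2 : ℝ) - (y.1.2 : ℝ)| ≤ p.length := by
  induction p with
  | nil => simp
  | @cons u v w hab p ih =>
    have h1 : |(u.1.2 : ℝ) - (v.1.2 : ℝ)| ≤ 1 := by
      rcases (strongPrism_chain_adj_iff _ _).1 hab with h | h
      · rw [h.1]; simp
      · rcases h.2 with h | h
        · rw [← h]; simp
        · rw [← h]; simp
    rw [SimpleGraph.Walk.length_cons]
    push_cast
    linarith [abs_sub_le (u.1.2 : ℝ) v.1.2 w.1.2]

theorem le_strongPrism_chain_dist (x y : (Fin 2 × Fin (n + 1)) × Fin 2) :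
    |(x.1.2 : ℝ) - (y.1.2 : ℝ)| ≤ (strongPrism (linearPolyominoChain n)).dist x y := by
  obtain ⟨p, hp⟩ := (strongPrism_chain_connected n).exists_walk_length_eq_dist x y
  rw [← hp]
  exact abs_layer_sub_le_length p

theorem strongPrism_chain_degree_le (x : (Fin 2 × Fin (n + 1)) × Fin 2) :
    (strongPrism (linearPolyominoChain n)).degree x ≤ 12 := by
  have hcard : Fintype.card (Fin 2 × Fin 3 × Fin 2) = 12 := by simp
  rw [← SimpleGraph.card_neighborFinset_eq_degree, ← hcard, ← Finset.card_univ]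
  have hlayer : ∀ y ∈ (strongPrism (linearPolyominoChain n)).neighborFinset x,
      (y.1.2 : ℕ) ≤ x.1.2 + 1 ∧ (x.1.2 : ℕ) ≤ y.1.2 + 1 := by
    intro y hy
    rw [SimpleGraph.mem_neighborFinset, strongPrism_chain_adj_iff] at hy
    rcases hy with h | h
    · rw [h.1]; omega
    · omega
  refine Finset.card_le_card_of_injOn
    -- The layer offset -1, 0 or 1 is shifted to 0, 1 or 2, so the truncated subtraction is exact.
    (fun y => (y.1.1, Fin.ofNat 3 ((y.1.2 : ℕ) + 1 - x.1.2), y.2))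
    (fun _ _ => by simp) ?_
  rintro ⟨⟨r, k⟩, a⟩ hy ⟨⟨s, l⟩, b⟩ hz h
  have h1 := hlayer _ hy
  have h2 := hlayer _ hz
  simp only [Prod.mk.injEq, Fin.ext_iff, Fin.ofNat] at h h1 h2 ⊢
  omega

theorem strongPrism_chain_one_le_degree (x : (Fin 2 × Fin (n + 1)) × Fin 2) :
    1 ≤ (strongPrism (linearPolyominoChain n)).degree x :=
  (strongPrism_chain_connected n).preconnected.degree_pos_of_nontrivial x

/-! ### Resistance through layer functions. -/

/-- The reflecting condition `hg` kills the term for the missing layer after the last. At the other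
end, in `sum_fin_add_one_eq`, truncation `0 - 1 = 0` does the same. -/
theorem sum_fin_eq_add_one (n : ℕ) (g : ℕ → ℝ) (k : Fin (n + 1)) (hg : g (n + 1) = g n) :
    ∑ l : Fin (n + 1), (if (k : ℕ) + 1 = l then g k - g l else 0) = g k - g (k + 1) := by
  by_cases h : (k : ℕ) + 1 < n + 1
  · rw [Finset.sum_eq_single (⟨k + 1, h⟩ : Fin (n + 1))]
    · simp
    · intro b _ hb
      rw [if_neg fun h' => hb (Fin.ext h'.symm)]
    · simp
  · have hk : (k : ℕ) = n := by omega
    rw [Finset.sum_eq_zero]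
    · rw [hk, hg, sub_self]
    · intro l _
      rw [if_neg (by omega)]

theorem sum_fin_add_one_eq (n : ℕ) (g : ℕ → ℝ) (k : Fin (n + 1)) :
    ∑ l : Fin (n + 1), (if (l : ℕ) + 1 = k then g k - g l else 0) = g k - g (k - 1) := by
  by_cases h : 0 < (k : ℕ)
  · rw [Finset.sum_eq_single (⟨k - 1, by omega⟩ : Fin (n + 1))]
    · rw [if_pos (by simp only; omega)]
    · intro b _ hb
      rw [if_neg fun h' => hb (Fin.ext (by simp only; omega))]
    · simp
  · have hk : (k : ℕ) = 0 := by omega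
    rw [Finset.sum_eq_zero]
    · simp [hk]
    · intro l _
      rw [if_neg (by omega)]

/-- The Laplacian of a function of the layer. -/
theorem sum_neighbors_layer (g : ℕ → ℝ) (hg : g (n + 1) = g n)
    (x : (Fin 2 × Fin (n + 1)) × Fin 2) :
    ∑ y ∈ (strongPrism (linearPolyominoChain n)).neighborFinset x, (g x.1.2 - g y.1.2) =
      2 * ((g x.1.2 - g (x.1.2 + 1)) + (g x.1.2 - g (x.1.2 - 1))) := by
  obtain ⟨⟨r, k⟩, a⟩ := x
  have hterm : ∀ y : (Fin 2 × Fin (n + 1)) × Fin 2,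
      (if (strongPrism (linearPolyominoChain n)).Adj ((r, k), a) y then g k - g y.1.2 else 0) =
      if r = y.1.1 then (if (k : ℕ) + 1 = y.1.2 then g k - g y.1.2 else 0) +
        (if (y.1.2 : ℕ) + 1 = k then g k - g y.1.2 else 0) else 0 := by
    rintro ⟨⟨s, l⟩, b⟩
    simp only [strongPrism_chain_adj_iff]
    by_cases hkl : k = l
    · subst hkl; simp
    · by_cases h1 : (k : ℕ) + 1 = l
      · have h2 : ¬ ((l : ℕ) + 1 = k) := by omega
        simp [hkl, h1, h2]
      · simp [hkl, h1, ite_and]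
  rw [SimpleGraph.neighborFinset_eq_filter, Finset.sum_filter, Finset.sum_congr rfl
    (fun y _ => hterm y), Fintype.sum_prod_type, Fintype.sum_prod_type]
  simp only [Finset.sum_const, Finset.card_univ, Fintype.card_fin, nsmul_eq_mul]
  rw [Finset.sum_eq_single r]
  · simp only [if_true, ← Finset.mul_sum, Finset.sum_add_distrib]
    rw [sum_fin_eq_add_one n g k hg, sum_fin_add_one_eq]
    push_cast
    ring
  · intro s _ hs
    simp [hs.symm]
  · simp

theorem sum_mul_layer_indicator (φ : (Fin 2 × Fin (n + 1)) × Fin 2 → ℝ) (k : Fin (n + 1)) :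
    ∑ x, φ x * (if x.1.2 = k then 1 else 0) = ∑ r : Fin 2, ∑ a : Fin 2, φ ((r, k), a) := by
  rw [Fintype.sum_prod_type, Fintype.sum_prod_type]
  refine Finset.sum_congr rfl fun r _ => ?_
  rw [Finset.sum_eq_single k]
  · simp
  · intro l _ hl
    simp [hl]
  · simp

/-- The layer averages of a unit potential drop by exactly `1 / 8` per layer crossed. -/
theorem sum_layer_sub_sum_layer {x y : (Fin 2 × Fin (n + 1)) × Fin 2}
    {φ : (Fin 2 × Fin (n + 1)) × Fin 2 → ℝ}
    (hφ : IsUnitPotential (strongPrism (linearPolyominoChain n)) x y φ)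
    (h : (x.1.2 : ℕ) ≤ y.1.2) :
    2 * (∑ r : Fin 2, ∑ a : Fin 2, φ ((r, x.1.2), a) -
      ∑ r : Fin 2, ∑ a : Fin 2, φ ((r, y.1.2), a)) = (y.1.2 : ℝ) - x.1.2 := by
  -- Minus the layer clamped between those of `x` and `y`: its Laplacian lives on these two layers
  -- only, so pairing it with `φ` isolates the two layer sums.
  let g : ℕ → ℝ := fun m => -((max (min m y.1.2) x.1.2 : ℕ) : ℝ)
  have hg : g (n + 1) = g n := by
    have h1 := y.1.2.2
    have h2 := x.1.2.2
    simp only [g]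
    congr 2
    omega
  have hlap : ∀ z : (Fin 2 × Fin (n + 1)) × Fin 2,
      ∑ w ∈ (strongPrism (linearPolyominoChain n)).neighborFinset z, (g z.1.2 - g w.1.2) =
        2 * ((if z.1.2 = x.1.2 then 1 else 0) - (if z.1.2 = y.1.2 then 1 else 0)) := by
    intro z
    rw [sum_neighbors_layer g hg]
    congr 1
    -- Stated over the integers so that `omega` settles every case.
    have key : (((max (min ((z.1.2 : ℕ) + 1) y.1.2) x.1.2 : ℕ) : ℤ) -
        ((max (min (z.1.2 : ℕ) y.1.2) x.1.2 : ℕ) : ℤ)) +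
        (((max (min ((z.1.2 : ℕ) - 1) y.1.2) x.1.2 : ℕ) : ℤ) -
        ((max (min (z.1.2 : ℕ) y.1.2) x.1.2 : ℕ) : ℤ)) =
        (if z.1.2 = x.1.2 then 1 else 0) - (if z.1.2 = y.1.2 then 1 else 0) := by
      simp only [Fin.ext_iff]
      split_ifs <;> omega
    have key' := congrArg (fun t : ℤ => (t : ℝ)) key
    simp only [Int.cast_add, Int.cast_sub, Int.cast_natCast, Int.cast_ite, Int.cast_one,
      Int.cast_zero] at key'
    rw [← key']
    simp only [g]
    ring
  have hmain := hφ.sum_mul_laplacian (fun z => g z.1.2)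
  simp only [hlap] at hmain
  have hx : g x.1.2 = -(x.1.2 : ℝ) := by
    simp only [g]; congr 2; omega
  have hy : g y.1.2 = -(y.1.2 : ℝ) := by
    simp only [g]; congr 2; omega
  rw [hx, hy] at hmain
  rw [← sum_mul_layer_indicator φ x.1.2, ← sum_mul_layer_indicator φ y.1.2,
    ← Finset.sum_sub_distrib, Finset.mul_sum]
  rw [Finset.sum_congr rfl fun z _ => ?_, hmain]
  · ring
  · ring

/-- The layer is a clique, so each of its four vertices lies below the source by at most 1. -/
theorem abs_source_sub_layer_sum {x y : (Fin 2 × Fin (n + 1)) × Fin 2}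
    {φ : (Fin 2 × Fin (n + 1)) × Fin 2 → ℝ}
    (hφ : IsUnitPotential (strongPrism (linearPolyominoChain n)) x y φ) :
    |4 * φ x - ∑ r : Fin 2, ∑ a : Fin 2, φ ((r, x.1.2), a)| ≤ 4 := by
  have hG := strongPrism_chain_connected n
  have hb : ∀ r a : Fin 2, φ ((r, x.1.2), a) ≤ φ x ∧ φ x ≤ φ ((r, x.1.2), a) + 1 := by
    intro r a
    refine ⟨hφ.le_source hG _, ?_⟩
    by_cases hne : x = ((r, x.1.2), a)
    · rw [← hne]; linarith
    · exact hφ.source_le_add_one hG (strongPrism_chain_adj_of_layer_eq rfl hne)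
  simp only [Fin.sum_univ_two]
  rw [abs_le]
  constructor <;> linarith [(hb 0 0).1, (hb 0 1).1, (hb 1 0).1,
    (hb 1 1).1, (hb 0 0).2, (hb 0 1).2, (hb 1 0).2, (hb 1 1).2]

theorem abs_resistanceDist_sub_le (x y : (Fin 2 × Fin (n + 1)) × Fin 2) :
    |resistanceDist (strongPrism (linearPolyominoChain n)) x y -
      |(x.1.2 : ℝ) - (y.1.2 : ℝ)| / 8| ≤ 2 := by
  wlog h : (x.1.2 : ℕ) ≤ y.1.2 generalizing x y
  · rw [resistanceDist_comm, abs_sub_comm (x.1.2 : ℝ)]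
    exact this y x (le_of_not_ge h)
  obtain ⟨φ, hφ⟩ := exists_isUnitPotential (strongPrism_chain_connected n) x y
  have hd := sum_layer_sub_sum_layer hφ h
  have hx := abs_le.1 (abs_source_sub_layer_sum hφ)
  -- The sink is the source of `-φ`. The two errors of 4 add up to 8, and division by 4 gives the
  -- bound 2.
  have hy := abs_le.1 (abs_source_sub_layer_sum hφ.neg)
  simp only [Pi.neg_apply, Finset.sum_neg_distrib] at hy
  have hle : (x.1.2 : ℝ) ≤ y.1.2 := by exact_mod_cast h
  rw [resistanceDist_eq hφ, abs_sub_comm (x.1.2 : ℝ), abs_of_nonneg (sub_nonneg.2 hle), abs_le]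
  constructor <;> linarith [hx.1, hx.2, hy.1, hy.2]

end Prism

/-! ### Size of the Gutman index and comparison of the two indices. -/

section Indices

theorem sum_natCast_sub_fin (N : ℕ) : ∑ k : Fin N, ((N : ℝ) - k) = N * (N + 1) / 2 := by
  rw [Fin.sum_univ_eq_sum_range (fun k => (N : ℝ) - k) N, Finset.sum_sub_distrib,
    Finset.sum_const, Finset.card_range, nsmul_eq_mul]
  have h : ∑ k ∈ Finset.range N, (k : ℝ) = N * (N - 1) / 2 := by
    induction N with
    | zero => simp
    | succ m ih => rw [Finset.sum_range_succ, ih]; push_cast; ring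
  rw [h]
  ring

theorem sum_abs_sub_fin (N : ℕ) :
    ∑ k : Fin N, ∑ l : Fin N, |(k : ℝ) - (l : ℝ)| = ((N : ℝ) ^ 3 - N) / 3 := by
  induction N with
  | zero => simp
  | succ N ih =>
    have h1 : ∀ k : Fin N, |(k : ℝ) - N| = N - k := by
      intro k
      have : (k : ℝ) ≤ N := by exact_mod_cast k.2.le
      rw [abs_sub_comm, abs_of_nonneg (sub_nonneg.2 this)]
    have h2 : ∀ k : Fin N, |(N : ℝ) - k| = N - k := by
      intro k
      rw [abs_sub_comm, h1]
    simp only [Fin.sum_univ_castSucc, Fin.val_castSucc, Fin.val_last, Finset.sum_add_distrib, ih,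
      h1, h2, sum_natCast_sub_fin, sub_self, abs_zero]
    push_cast
    ring

theorem sum_abs_layer_sub (n : ℕ) :
    ∑ x : (Fin 2 × Fin (n + 1)) × Fin 2, ∑ y : (Fin 2 × Fin (n + 1)) × Fin 2,
      |(x.1.2 : ℝ) - (y.1.2 : ℝ)| = 16 * (n * (n + 1) * (n + 2)) / 3 := by
  simp only [Fintype.sum_prod_type, Finset.sum_const, Finset.card_univ, Fintype.card_fin,
    nsmul_eq_mul, ← Finset.mul_sum, sum_abs_sub_fin]
  push_cast
  ring

theorem le_gutmanIndex_strongPrism_chain (n : ℕ) :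
    8 * ((n : ℝ) * (n + 1) * (n + 2)) / 3 ≤
      gutmanIndex (strongPrism (linearPolyominoChain n)) := by
  have h : ∑ x : (Fin 2 × Fin (n + 1)) × Fin 2, ∑ y : (Fin 2 × Fin (n + 1)) × Fin 2,
      |(x.1.2 : ℝ) - (y.1.2 : ℝ)| ≤
      ∑ x, ∑ y, ((strongPrism (linearPolyominoChain n)).degree x : ℝ) *
        ((strongPrism (linearPolyominoChain n)).degree y : ℝ) *
        ((strongPrism (linearPolyominoChain n)).dist x y : ℝ) := by
    refine Finset.sum_le_sum fun x _ => Finset.sum_le_sum fun y _ => ?_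
    refine (le_strongPrism_chain_dist x y).trans (le_mul_of_one_le_left (Nat.cast_nonneg _) ?_)
    exact_mod_cast Nat.mul_pos (strongPrism_chain_one_le_degree x)
      (strongPrism_chain_one_le_degree y)
  rw [sum_abs_layer_sub] at h
  unfold gutmanIndex
  linarith

theorem abs_degreeKirchhoffIndex_sub_le (n : ℕ) :
    |degreeKirchhoffIndex (strongPrism (linearPolyominoChain n)) -
      gutmanIndex (strongPrism (linearPolyominoChain n)) / 8| ≤ 3456 * ((n : ℝ) + 1) ^ 2 := by
  have hterm : ∀ x y : (Fin 2 × Fin (n + 1)) × Fin 2,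
      |((strongPrism (linearPolyominoChain n)).degree x : ℝ) *
        ((strongPrism (linearPolyominoChain n)).degree y : ℝ) *
        (resistanceDist (strongPrism (linearPolyominoChain n)) x y -
          ((strongPrism (linearPolyominoChain n)).dist x y : ℝ) / 8)| ≤ 12 * 12 * 3 := by
    intro x y
    have h1 := abs_le.1 (abs_resistanceDist_sub_le x y)
    have h2 := strongPrism_chain_dist_le x y
    have h3 := le_strongPrism_chain_dist x y
    have hx : ((strongPrism (linearPolyominoChain n)).degree x : ℝ) ≤ 12 := by
      exact_mod_cast strongPrism_chain_degree_le x
    have hy : ((strongPrism (linearPolyominoChain n)).degree y : ℝ) ≤ 12 := by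
      exact_mod_cast strongPrism_chain_degree_le y
    have hr : |resistanceDist (strongPrism (linearPolyominoChain n)) x y -
        ((strongPrism (linearPolyominoChain n)).dist x y : ℝ) / 8| ≤ 3 := by
      rw [abs_le]
      constructor <;> linarith [h1.1, h1.2]
    rw [abs_mul, abs_mul, Nat.abs_cast, Nat.abs_cast]
    gcongr
  have heq : degreeKirchhoffIndex (strongPrism (linearPolyominoChain n)) -
      gutmanIndex (strongPrism (linearPolyominoChain n)) / 8 =
      (1 / 2) * ∑ x, ∑ y, ((strongPrism (linearPolyominoChain n)).degree x : ℝ) *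
        ((strongPrism (linearPolyominoChain n)).degree y : ℝ) *
        (resistanceDist (strongPrism (linearPolyominoChain n)) x y -
          ((strongPrism (linearPolyominoChain n)).dist x y : ℝ) / 8) := by
    simp only [degreeKirchhoffIndex, gutmanIndex, mul_sub, Finset.sum_sub_distrib,
      ← mul_div_assoc, ← Finset.sum_div]
  rw [heq, abs_mul, abs_of_pos (by norm_num : (0 : ℝ) < 1 / 2)]
  have hsum := (Finset.abs_sum_le_sum_abs (fun x => ∑ y,
    ((strongPrism (linearPolyominoChain n)).degree x : ℝ) *
        ((strongPrism (linearPolyominoChain n)).degree y : ℝ) *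
        (resistanceDist (strongPrism (linearPolyominoChain n)) x y -
          ((strongPrism (linearPolyominoChain n)).dist x y : ℝ) / 8)) Finset.univ).trans
    (Finset.sum_le_sum fun x _ => (Finset.abs_sum_le_sum_abs _ _).trans
      (Finset.sum_le_sum fun y _ => hterm x y))
  simp only [Finset.sum_const, Finset.card_univ, Fintype.card_prod, Fintype.card_fin,
    nsmul_eq_mul] at hsum
  push_cast at hsum
  linarith

end Indices

theorem theorem3p7 :
    Tendsto (fun n : ℕ => degreeKirchhoffIndex (strongPrism (linearPolyominoChain n)) /
      gutmanIndex (strongPrism (linearPolyominoChain n))) atTop (𝓝 (1 / 8 : ℝ)) := by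
  rw [tendsto_iff_dist_tendsto_zero]
  refine squeeze_zero' (Eventually.of_forall fun _ => dist_nonneg) ?_
    (tendsto_const_div_atTop_nhds_zero_nat 1296)
  filter_upwards [eventually_ge_atTop 1] with n hn
  have hn' : (1 : ℝ) ≤ n := by exact_mod_cast hn
  have hgut := le_gutmanIndex_strongPrism_chain n
  have hdiff := abs_degreeKirchhoffIndex_sub_le n
  set K := degreeKirchhoffIndex (strongPrism (linearPolyominoChain n))
  set Γ := gutmanIndex (strongPrism (linearPolyominoChain n))
  have hΓ : 0 < Γ := lt_of_lt_of_le (by positivity) hgut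
  have heq : K / Γ - 1 / 8 = (K - Γ / 8) / Γ := by field_simp
  rw [Real.dist_eq, heq, abs_div, abs_of_pos hΓ, div_le_div_iff₀ hΓ (by positivity)]
  calc |K - Γ / 8| * n ≤ 3456 * ((n : ℝ) + 1) ^ 2 * n := by gcongr
    _ ≤ 1296 * (8 * ((n : ℝ) * (n + 1) * (n + 2)) / 3) := by
        nlinarith [mul_pos (by linarith : (0 : ℝ) < n) (by linarith : (0 : ℝ) < n + 1)]
    _ ≤ 1296 * Γ := by gcongr
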